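/- Let $\mathcal H$ be a complex Hilbert space and let $T\in\mathcal B(\mathcal H)$ be a pure quasinormal operator: $T$ commutes with its modulus $|T|=(T^*T)^{1/2}$, and there is no closed reducing subspace $\mathcal M\neq\{0\}$ of $T$ such that $T|_{\mathcal M}$ is normal. Let $T=V_T|T|$ be the polar decomposition, put $\mathfrak L_T=\mathcal H\ominus V_T\mathcal H$, which is invariant under $|T|$, and let $A_T=|T|\,|_{\mathfrak L_T}$. Identify $\mathfrak L_T\otimes H^2$ with $\bigoplus_{k\ge 0}\mathfrak L_T$, where $S$ is the unilateral shift on $H^2$, so that $I\otimes S$ is the map $(x_0,x_1,\dots)\mapsto(0,x_0,x_1,\dots)$ and $A_T\otimes S$ is the map $(x_0,x_1,\dots)\mapsto(0,A_Tx_0,A_Tx_1,\dots)$. Let $\sigma_{ext}(T)$ be the set of $\lambda\in\mathbb C$ for which there is a nonzero $X\in\mathcal B(\mathcal H)$ (an extended eigenvector for $\lambda$) with $TX=\lambda XT$, and let $E_{ext}(T,\lambda)$ be the linear span of the extended eigenvectors for $\lambda$. For $r>0$ let \[ \mathcal A_r(A_T)=\{L\in\mathcal B(\mathfrak L_T):\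 \exists c\ge 0\ \ \forall x\in\mathfrak L_T\ \ \forall n\in\mathbb N,\ \ \|r^{-n}A_T^nLx\|\le c\|A_T^nx\|\}. \] Let $\lambda\in\sigma_{ext}(T)$ (so $\lambda\ne0$). Then there is a unitary operator $U_T:\mathcal H\to\mathfrak L_T\otimes H^2$ with $U_TTU_T^*=A_T\otimes S$, and for every such $U_T$, \[ E_{ext}(T,\lambda)=\overline{\operatorname{span}}^{\,w^*}\bigl\{U_T^*(I\otimes S^m)\,\mathrm{diag}(L,X_{1,1},X_{2,2},\dots)\,U_T:\ m\in\mathbb N,\ L\in\mathcal A_{|\lambda|}(A_T)\bigr\}, \] where the closure of the linear span is taken in the weak* topology of $\mathcal B(\mathcal H)$ (as the dual of the trace class operators), $\mathbb N$ contains $0$, and, for each $L$ and $n\ge1$, $X_{n,n}\in\mathcal B(\mathfrak L_T)$ is the unique bounded extension to $\mathfrak L_T$ of the map $A_T^nx\mapsto\lambda^{-n}A_T^nLx$ defined on the (dense) range of $A_T^n$. -/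

import Mathlib

open scoped InnerProductSpace ENNReal

noncomputable section

namespace ExtEig

universe u

variable {H : Type u} [NormedAddCommGroup H] [InnerProductSpace ℂ H] [CompleteSpace H]

/-! ### Extended eigenvalues and extended eigenspaces -/

/-- `X` satisfies `T X = lam X T` and is nonzero. -/
def IsExtEigenvector (T : H →L[ℂ] H) (lam : ℂ) (X : H →L[ℂ] H) : Prop :=
  X ≠ 0 ∧ T ∘L X = lam • (X ∘L T)

/-- The extended spectrum of `T`. -/
def extSpectrum (T : H →L[ℂ] H) : Set ℂ :=
  {lam | ∃ X : H →L[ℂ] H, IsExtEigenvector T lam X}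

/-- The subspace generated by the extended eigenvectors of `T` associated with `lam`. -/
def extEigenspace (T : H →L[ℂ] H) (lam : ℂ) : Submodule ℂ (H →L[ℂ] H) :=
  Submodule.span ℂ {X | IsExtEigenvector T lam X}

/-! ### The weak* topology of `B(H)` -/

/-- The weak* (that is, ultraweak) topology of `B(H)`, as the dual of the trace class operators:
the coarsest topology for which every functional `X ↦ ∑ₙ ⟪yₙ, X xₙ⟫` is continuous, where
`∑ ‖xₙ‖² < ∞` and `∑ ‖yₙ‖² < ∞`. -/
@[reducible]
def weakStarTopology (H : Type u) [NormedAddCommGroup H] [InnerProductSpace ℂ H] :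
    TopologicalSpace (H →L[ℂ] H) :=
  ⨅ (x : lp (fun _ : ℕ => H) 2) (y : lp (fun _ : ℕ => H) 2),
    TopologicalSpace.induced (fun X : H →L[ℂ] H => ∑' n, ⟪y n, X (x n)⟫_ℂ) inferInstance

/-- The weak*-closed linear span of a set of operators. -/
def weakStarSpan (s : Set (H →L[ℂ] H)) : Set (H →L[ℂ] H) :=
  @closure _ (weakStarTopology H) (Submodule.span ℂ s : Set (H →L[ℂ] H))

/-! ### Pure quasinormal operators -/

/-- `T` commutes with its modulus `|T| = (T* T)^(1/2)`. -/
def IsQuasinormal (T : H →L[ℂ] H) : Prop :=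
  T * CFC.abs T = CFC.abs T * T

/-- `T` is pure: it has no nonzero (closed) reducing subspace on which it is normal. -/
def IsPure (T : H →L[ℂ] H) : Prop :=
  ∀ (M : Submodule ℂ H) [CompleteSpace M] (hM : Set.MapsTo T M M),
    Set.MapsTo (ContinuousLinearMap.adjoint T) M M → IsStarNormal (T.restrict hM) → M = ⊥

/-- `T` is a pure quasinormal operator. -/
structure IsPureQuasinormal (T : H →L[ℂ] H) : Prop where
  quasinormal : IsQuasinormal T
  pure : IsPure T

/-! ### Polar decomposition -/

/-- The closure of the range of `|T|`, the initial space of the polar decomposition of `T`. -/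
def initialSpace (T : H →L[ℂ] H) : Submodule ℂ H :=
  (LinearMap.range (CFC.abs T).toLinearMap).topologicalClosure

instance initialSpace_complete (T : H →L[ℂ] H) : CompleteSpace (initialSpace T) :=
  (Submodule.isClosed_topologicalClosure _).completeSpace_coe

/-- `|T|` as a map into the closure of its range. -/
def absToInitial (T : H →L[ℂ] H) : H →ₗ[ℂ] initialSpace T :=
  (CFC.abs T).toLinearMap.codRestrict (initialSpace T) fun x =>
    Submodule.le_topologicalClosure _ (LinearMap.mem_range_self _ x)

/-- The partial isometry `V_T` of the polar decomposition `T = V_T |T|`: it is the continuous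
extension of `|T| x ↦ T x` on the closure of the range of `|T|`, and `0` on the orthogonal
complement. -/
def polarIsometry (T : H →L[ℂ] H) : H →L[ℂ] H :=
  (T.toLinearMap.extendOfNorm (absToInitial T)) ∘L (initialSpace T).orthogonalProjectionOnto

theorem abs_isSelfAdjoint (T : H →L[ℂ] H) : IsSelfAdjoint (CFC.abs T) :=
  IsSelfAdjoint.of_nonneg (CFC.abs_nonneg T)

theorem inner_abs_left (T : H →L[ℂ] H) (x y : H) :
    ⟪CFC.abs T x, y⟫_ℂ = ⟪x, CFC.abs T y⟫_ℂ := by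
  have h := ContinuousLinearMap.adjoint_inner_right (CFC.abs T) x y
  rw [(ContinuousLinearMap.isSelfAdjoint_iff'.mp (abs_isSelfAdjoint T))] at h
  exact h.symm

theorem norm_abs_apply (T : H →L[ℂ] H) (x : H) : ‖CFC.abs T x‖ = ‖T x‖ := by
  have h1 : ⟪CFC.abs T x, CFC.abs T x⟫_ℂ = ⟪T x, T x⟫_ℂ := by
    rw [inner_abs_left, ← mul_apply_eq_comp, CFC.abs_mul_abs,
      ContinuousLinearMap.star_eq_adjoint, mul_apply_eq_comp,
      ContinuousLinearMap.adjoint_inner_right]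
  rw [inner_self_eq_norm_sq_to_K, inner_self_eq_norm_sq_to_K] at h1
  have h2 : ‖CFC.abs T x‖ ^ 2 = ‖T x‖ ^ 2 := by exact_mod_cast h1
  exact (sq_eq_sq₀ (norm_nonneg _) (norm_nonneg _)).mp h2

theorem denseRange_absToInitial (T : H →L[ℂ] H) : DenseRange (absToInitial T) := by
  intro y
  rw [Metric.mem_closure_iff]
  intro ε hε
  have hy : (y : H) ∈ closure (LinearMap.range (CFC.abs T).toLinearMap : Set H) := by
    rw [← Submodule.topologicalClosure_coe]
    exact y.2
  obtain ⟨_, ⟨x, rfl⟩, hx⟩ := Metric.mem_closure_iff.mp hy ε hε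
  exact ⟨_, ⟨x, rfl⟩, hx⟩

/-- The polar decomposition `T = V_T |T|`. -/
theorem polarIsometry_abs (T : H →L[ℂ] H) (x : H) : polarIsometry T (CFC.abs T x) = T x := by
  have h1 : (initialSpace T).orthogonalProjectionOnto (CFC.abs T x) = absToInitial T x :=
    Submodule.orthogonalProjectionOnto_mem_subspace_eq_self (absToInitial T x)
  rw [polarIsometry, ContinuousLinearMap.comp_apply, h1]
  exact LinearMap.extendOfNorm_eq (denseRange_absToInitial T)
    ⟨1, fun z => by
      rw [one_mul]
      exact (norm_abs_apply T z).ge⟩ x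

/-- `V_T` vanishes on the kernel of `T`. -/
theorem polarIsometry_of_apply_eq_zero (T : H →L[ℂ] H) (x : H) (hx : T x = 0) :
    polarIsometry T x = 0 := by
  have h0 : CFC.abs T x = 0 := by rw [← norm_eq_zero, norm_abs_apply, hx, norm_zero]
  have h1 : x ∈ (initialSpace T)ᗮ := by
    rw [initialSpace, Submodule.orthogonal_closure, Submodule.mem_orthogonal]
    rintro _ ⟨z, rfl⟩
    change ⟪CFC.abs T z, x⟫_ℂ = 0
    rw [inner_abs_left, h0, inner_zero_right]
  rw [polarIsometry, ContinuousLinearMap.comp_apply,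
    Submodule.orthogonalProjectionOnto_apply_of_mem_orthogonal h1, map_zero]

/-- For quasinormal `T` the factors of the polar decomposition commute. -/
theorem polarIsometry_commute (T : H →L[ℂ] H) (hT : IsQuasinormal T) (x : H) :
    polarIsometry T (CFC.abs T x) = CFC.abs T (polarIsometry T x) := by
  have hc : ∀ z, T (CFC.abs T z) = CFC.abs T (T z) := fun z => congrArg (fun S => S z) hT
  have hx : x ∈ initialSpace T ⊔ (initialSpace T)ᗮ := by
    rw [Submodule.sup_orthogonal_of_hasOrthogonalProjection]
    trivial
  obtain ⟨y, hy, z, hz, rfl⟩ := Submodule.mem_sup.mp hx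
  have h1 : polarIsometry T (CFC.abs T y) = CFC.abs T (polarIsometry T y) := by
    have hcl : IsClosed {w | polarIsometry T (CFC.abs T w) = CFC.abs T (polarIsometry T w)} :=
      isClosed_eq (by fun_prop) (by fun_prop)
    have hy' : y ∈ closure (LinearMap.range (CFC.abs T).toLinearMap : Set H) := by
      rw [← Submodule.topologicalClosure_coe]
      exact hy
    refine hcl.closure_subset_iff.mpr ?_ hy'
    rintro _ ⟨w, rfl⟩
    change polarIsometry T (CFC.abs T (CFC.abs T w)) = CFC.abs T (polarIsometry T (CFC.abs T w))
    rw [polarIsometry_abs, polarIsometry_abs, hc]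
  have h0 : CFC.abs T z = 0 := by
    refine ext_inner_left ℂ fun w => ?_
    rw [← inner_abs_left, inner_zero_right]
    exact (Submodule.mem_orthogonal _ _).mp hz _
      (Submodule.le_topologicalClosure _ (LinearMap.mem_range_self _ w))
  have h2 : polarIsometry T z = 0 := polarIsometry_of_apply_eq_zero T z (by
    rw [← norm_eq_zero, ← norm_abs_apply, h0, norm_zero])
  rw [map_add, map_add, map_add, map_add, h1, h0, h2, map_zero, map_zero]

/-! ### The space `𝔏_T` and the operator `A_T` -/

/-- `𝔏_T = H ⊖ V_T H`. -/
def defectSpace (T : H →L[ℂ] H) : Submodule ℂ H :=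
  (LinearMap.range (polarIsometry T).toLinearMap)ᗮ

instance defectSpace_complete (T : H →L[ℂ] H) : CompleteSpace (defectSpace T) :=
  (Submodule.isClosed_orthogonal _).completeSpace_coe

theorem abs_mapsTo_defectSpace (T : H →L[ℂ] H) (hT : IsQuasinormal T) :
    Set.MapsTo (CFC.abs T : H →L[ℂ] H) (defectSpace T) (defectSpace T) := by
  intro x hx
  refine (Submodule.mem_orthogonal _ _).mpr ?_
  rintro _ ⟨z, rfl⟩
  change ⟪polarIsometry T z, CFC.abs T x⟫_ℂ = 0
  rw [← inner_abs_left, ← polarIsometry_commute T hT]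
  exact (Submodule.mem_orthogonal _ _).mp hx _ (LinearMap.mem_range_self _ _)

/-- `A_T`, the restriction of `|T|` to the invariant subspace `𝔏_T`. -/
def defectOp (T : H →L[ℂ] H) (hT : IsPureQuasinormal T) : defectSpace T →L[ℂ] defectSpace T :=
  (CFC.abs T).restrict (abs_mapsTo_defectSpace T hT.quasinormal)

/-- A pure quasinormal operator is injective. -/
theorem ker_eq_bot (T : H →L[ℂ] H) (hT : IsPureQuasinormal T) :
    LinearMap.ker T.toLinearMap = ⊥ := by
  have habs : ∀ x, T x = 0 ↔ CFC.abs T x = 0 := fun x => by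
    rw [← norm_eq_zero, ← norm_abs_apply, norm_eq_zero]
  have hcl : IsClosed (LinearMap.ker T.toLinearMap : Set H) := T.isClosed_ker
  have : CompleteSpace (LinearMap.ker T.toLinearMap) := hcl.completeSpace_coe
  have hM : Set.MapsTo T (LinearMap.ker T.toLinearMap) (LinearMap.ker T.toLinearMap) := by
    intro x hx
    have hx' : T x = 0 := hx
    change T (T x) = 0
    rw [hx', map_zero]
  refine hT.pure _ hM ?_ ?_
  · intro x hx
    change T (ContinuousLinearMap.adjoint T x) = 0
    rw [habs]
    have hx' : CFC.abs T x = 0 := (habs x).mp hx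
    refine ext_inner_left ℂ fun w => ?_
    have hc : T (CFC.abs T w) = CFC.abs T (T w) := congrArg (fun S => S w) hT.quasinormal
    rw [← inner_abs_left, ContinuousLinearMap.adjoint_inner_right, hc, inner_abs_left, hx',
      inner_zero_right, inner_zero_right]
  · have h0 : T.restrict hM = 0 := by
      ext x
      exact x.2
    rw [h0]
    exact ⟨Commute.zero_right _⟩

/-- The powers of `A_T` have dense range. -/
theorem denseRange_defectOp_pow (T : H →L[ℂ] H) (hT : IsPureQuasinormal T) (n : ℕ) :
    DenseRange (defectOp T hT ^ n) := by
  have hsa : ∀ x y : defectSpace T, ⟪defectOp T hT x, y⟫_ℂ = ⟪x, defectOp T hT y⟫_ℂ :=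
    fun x y => inner_abs_left T x y
  have h1 : DenseRange (defectOp T hT) := by
    have h2 : (LinearMap.range (defectOp T hT).toLinearMap).topologicalClosure = ⊤ := by
      rw [Submodule.topologicalClosure_eq_top_iff, Submodule.eq_bot_iff]
      intro x hx
      have h3 : defectOp T hT x = 0 := by
        refine ext_inner_left ℂ fun w => ?_
        rw [← hsa, inner_zero_right]
        exact (Submodule.mem_orthogonal _ _).mp hx _ (LinearMap.mem_range_self _ w)
      have h4 : CFC.abs T (x : H) = 0 := congrArg Subtype.val h3
      have h5 : (x : H) ∈ LinearMap.ker T.toLinearMap := by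
        change T (x : H) = 0
        rw [← norm_eq_zero, ← norm_abs_apply, h4, norm_zero]
      rw [ker_eq_bot T hT, Submodule.mem_bot] at h5
      exact Subtype.ext h5
    have h6 := congrArg (fun M : Submodule ℂ (defectSpace T) => (M : Set (defectSpace T))) h2
    simp only [Submodule.topologicalClosure_coe, Submodule.top_coe] at h6
    exact dense_iff_closure_eq.mpr h6
  induction n with
  | zero =>
    rw [pow_zero]
    exact fun x => subset_closure ⟨x, rfl⟩
  | succ k ih =>
    rw [pow_succ]
    exact ih.comp h1 (defectOp T hT ^ k).continuous

/-! ### The sets `𝒜_r(A, B)` -/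

/-- `𝒜_r(A, B)`: the operators `L` for which there is `c ≥ 0` with
`‖r⁻ⁿ Aⁿ L x‖ ≤ c ‖Bⁿ x‖` for all `x` and all `n`. -/
def deddens {H₁ H₂ : Type*} [NormedAddCommGroup H₁] [InnerProductSpace ℂ H₁]
    [NormedAddCommGroup H₂] [InnerProductSpace ℂ H₂]
    (r : ℝ) (A : H₁ →L[ℂ] H₁) (B : H₂ →L[ℂ] H₂) : Set (H₂ →L[ℂ] H₁) :=
  {L | ∃ c : ℝ, 0 ≤ c ∧ ∀ (x : H₂) (n : ℕ), ‖(r⁻¹ ^ n) • (A ^ n) (L x)‖ ≤ c * ‖(B ^ n) x‖}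

/-! ### Operators on `K ⊗ H²`, identified with the Hilbert sum of countably many copies of `K` -/

section Model

variable {K : Type u} [NormedAddCommGroup K] [InnerProductSpace ℂ K]

/-- The Hilbert space `K ⊗ H² = ⊕_{k ≥ 0} K` of square summable sequences in `K`. -/
abbrev HardyTensor (K : Type u) [NormedAddCommGroup K] : Type u :=
  lp (fun _ : ℕ => K) 2

/-- The sequence `(0, f 0, f 1, …)`. -/
def shiftFun (f : ℕ → K) : ℕ → K
  | 0 => 0
  | n + 1 => f n

theorem hasSum_shiftFun {K : Type u} [NormedAddCommGroup K] (f : HardyTensor K) :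
    HasSum (fun n => ‖shiftFun f n‖ ^ (2 : ℝ≥0∞).toReal) (‖f‖ ^ (2 : ℝ≥0∞).toReal) := by
  have h := lp.hasSum_norm (p := 2) (by norm_num) f
  rw [← hasSum_nat_add_iff' 1]
  simpa [shiftFun] using h

/-- `I ⊗ S`, the shift `(x₀, x₁, …) ↦ (0, x₀, x₁, …)`. -/
def shift (K : Type u) [NormedAddCommGroup K] [InnerProductSpace ℂ K] :
    HardyTensor K →L[ℂ] HardyTensor K :=
  LinearMap.mkContinuous
    { toFun := fun f => ⟨shiftFun f, memℓp_gen (hasSum_shiftFun f).summable⟩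
      map_add' := fun f g => by
        ext n
        cases n
        · exact (add_zero (0 : K)).symm
        · rfl
      map_smul' := fun c f => by
        ext n
        cases n <;> simp [shiftFun] }
    1 fun f => by
      rw [one_mul]
      refine lp.norm_le_of_tsum_le (by norm_num) (norm_nonneg _) ?_
      exact (hasSum_shiftFun f).tsum_eq.le

theorem summable_diag (X : ℕ → K →L[ℂ] K) {C : ℝ} (hX : ∀ n, ‖X n‖ ≤ C) (f : HardyTensor K) :
    Summable (fun n => ‖X n (f n)‖ ^ (2 : ℝ≥0∞).toReal) ∧
      ∑' n, ‖X n (f n)‖ ^ (2 : ℝ≥0∞).toReal ≤ (C * ‖f‖) ^ (2 : ℝ≥0∞).toReal := by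
  have hC : 0 ≤ C := (norm_nonneg _).trans (hX 0)
  have h := (lp.hasSum_norm (p := 2) (by norm_num) f).mul_left (C ^ (2 : ℝ≥0∞).toReal)
  have hle : ∀ n, ‖X n (f n)‖ ^ (2 : ℝ≥0∞).toReal ≤
      C ^ (2 : ℝ≥0∞).toReal * ‖f n‖ ^ (2 : ℝ≥0∞).toReal := fun n => by
    rw [← Real.mul_rpow hC (norm_nonneg _)]
    exact Real.rpow_le_rpow (norm_nonneg _) ((X n).le_of_opNorm_le (hX n) _) (by norm_num)
  have hs : Summable (fun n => ‖X n (f n)‖ ^ (2 : ℝ≥0∞).toReal) :=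
    h.summable.of_nonneg_of_le (fun n => by positivity) hle
  refine ⟨hs, ?_⟩
  rw [Real.mul_rpow hC (norm_nonneg _)]
  exact (hs.tsum_le_tsum hle h.summable).trans_eq h.tsum_eq

/-- `diag(X₀, X₁, …)` for a bounded sequence of operators. -/
def diag (X : ℕ → K →L[ℂ] K) (hX : ∃ C, ∀ n, ‖X n‖ ≤ C) :
    HardyTensor K →L[ℂ] HardyTensor K :=
  LinearMap.mkContinuous
    { toFun := fun f => ⟨fun n => X n (f n), memℓp_gen (summable_diag X hX.choose_spec f).1⟩
      map_add' := fun f g => by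
        ext n
        exact map_add (X n) (f n) (g n)
      map_smul' := fun c f => by
        ext n
        simp }
    hX.choose fun f =>
      lp.norm_le_of_tsum_le (by norm_num)
        (mul_nonneg ((norm_nonneg _).trans (hX.choose_spec 0)) (norm_nonneg _))
        (summable_diag X hX.choose_spec f).2

/-- `A ⊗ S = (A ⊗ I)(I ⊗ S)`. -/
def tensorShift (A : K →L[ℂ] K) : HardyTensor K →L[ℂ] HardyTensor K :=
  diag (fun _ => A) ⟨‖A‖, fun _ => le_rfl⟩ ∘L shift K

/-- The bounded extension to `K` of the map `Aⁿ x ↦ lam⁻ⁿ Aⁿ L x` on the range of `Aⁿ`. -/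
def diagEntry [CompleteSpace K] (A : K →L[ℂ] K) (lam : ℂ) (L : K →L[ℂ] K) (n : ℕ) : K →L[ℂ] K :=
  ((lam⁻¹ ^ n) • (A ^ n * L)).toLinearMap.extendOfNorm (A ^ n).toLinearMap

theorem diagEntry_bound {A : K →L[ℂ] K} {lam : ℂ} {L : K →L[ℂ] K} {c : ℝ}
    (hc : ∀ (x : K) (n : ℕ), ‖(‖lam‖⁻¹ ^ n) • (A ^ n) (L x)‖ ≤ c * ‖(A ^ n) x‖) (n : ℕ) (x : K) :
    ‖((lam⁻¹ ^ n) • (A ^ n * L)).toLinearMap x‖ ≤ c * ‖(A ^ n).toLinearMap x‖ := by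
  refine le_trans (le_of_eq ?_) (hc x n)
  change ‖(lam⁻¹ ^ n) • (A ^ n) (L x)‖ = _
  rw [norm_smul, norm_smul]
  simp

/-- `diagEntry` does extend `Aⁿ x ↦ lam⁻ⁿ Aⁿ L x`. -/
theorem diagEntry_apply [CompleteSpace K] {A : K →L[ℂ] K} (hA : ∀ n : ℕ, DenseRange (A ^ n : K →L[ℂ] K))
    {lam : ℂ} {L : K →L[ℂ] K} (hL : L ∈ deddens ‖lam‖ A A) (n : ℕ) (x : K) :
    diagEntry A lam L n ((A ^ n) x) = (lam⁻¹ ^ n) • (A ^ n) (L x) := by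
  obtain ⟨c, -, hc⟩ := hL
  exact LinearMap.extendOfNorm_eq (hA n) ⟨c, diagEntry_bound hc n⟩ x

theorem diagEntry_bounded [CompleteSpace K] {A : K →L[ℂ] K} (hA : ∀ n : ℕ, DenseRange (A ^ n : K →L[ℂ] K))
    {lam : ℂ} {L : K →L[ℂ] K} (hL : L ∈ deddens ‖lam‖ A A) :
    ∃ C, ∀ n, ‖diagEntry A lam L n‖ ≤ C := by
  obtain ⟨c, hc0, hc⟩ := hL
  exact ⟨c, fun n => LinearMap.opNorm_extendOfNorm_le (hA n) hc0 (diagEntry_bound hc n)⟩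

end Model

/-! ### The model unitary and the generators -/

/-- `U` is a unitary from `H` onto `𝔏_T ⊗ H²` with `U T U* = A_T ⊗ S`. -/
def IsModelUnitary (T : H →L[ℂ] H) (hT : IsPureQuasinormal T)
    (U : H ≃ₗᵢ[ℂ] HardyTensor (defectSpace T)) : Prop :=
  ∀ f, U (T (U.symm f)) = tensorShift (defectOp T hT) f

/-- `diag(L, X₁₁, X₂₂, …)` on `𝔏_T ⊗ H²`, where `Xₙₙ` is the bounded extension of
`A_Tⁿ x ↦ lam⁻ⁿ A_Tⁿ L x`; the entry of index `0` is `L` itself. -/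
def diagOp (T : H →L[ℂ] H) (hT : IsPureQuasinormal T) (lam : ℂ)
    (L : defectSpace T →L[ℂ] defectSpace T)
    (hL : L ∈ deddens ‖lam‖ (defectOp T hT) (defectOp T hT)) :
    HardyTensor (defectSpace T) →L[ℂ] HardyTensor (defectSpace T) :=
  diag (diagEntry (defectOp T hT) lam L)
    (diagEntry_bounded (denseRange_defectOp_pow T hT) hL)

/-- The operators `U* (I ⊗ Sᵐ) diag(L, X₁₁, X₂₂, …) U` with `m ∈ ℕ` and `L ∈ 𝒜_{|lam|}(A_T)`. -/
def generators (T : H →L[ℂ] H) (hT : IsPureQuasinormal T) (lam : ℂ)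
    (U : H ≃ₗᵢ[ℂ] HardyTensor (defectSpace T)) : Set (H →L[ℂ] H) :=
  {Y | ∃ (m : ℕ) (L : defectSpace T →L[ℂ] defectSpace T)
      (hL : L ∈ deddens ‖lam‖ (defectOp T hT) (defectOp T hT)),
      Y = (U.symm.toContinuousLinearEquiv : HardyTensor (defectSpace T) →L[ℂ] H) ∘L
        ((shift (defectSpace T) ^ m) ∘L diagOp T hT lam L hL) ∘L
          (U.toContinuousLinearEquiv : H →L[ℂ] HardyTensor (defectSpace T))}

end ExtEig

end

/-!
Write `T = V|T|`. The isometry `V` commutes with `|T|`, so the unitary part `⋂ₙ Vⁿ H` of its Wold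
decomposition reduces `T` to a normal operator; purity makes it vanish, whence `H = ⊕ₙ Vⁿ 𝔏_T` and
`T` becomes `A_T ⊗ S`.

An operator `Y` with `(A ⊗ S) Y = lam Y (A ⊗ S)` has a lower triangular matrix whose `m`-th diagonal
is determined by its first entry `L = Y_{m,0}`, since `Y_{m+j,j} Aʲ = lam⁻ʲ Aʲ L`; boundedness of
`Y` puts `L` in `𝒜_{|lam|}(A)`. Summing the diagonals by Fejér means gives elements of the span of
the generators that converge to `Y` entrywise. The `N`-th mean is `N⁻¹ ∑ₖ Qₖ Y Qₖ`, with `Qₖ` the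
projection onto the coordinates `k - N < j ≤ k`; as each coordinate lies in `N` of these windows,
Cauchy–Schwarz bounds its norm by `‖Y‖`, and bounded entrywise convergence is weak* convergence.
-/

noncomputable section

namespace ExtEig

universe u v

section Wold

variable {𝕜 E : Type*} [RCLike 𝕜] [NormedAddCommGroup E] [InnerProductSpace 𝕜 E]

/-- `W` is the wandering subspace `E ⊖ V E` of the isometry `V`. A predicate rather than a
definition of `W`, so that the summands below can be indexed by `𝔏_T` itself. -/
def IsWanderingSubspace (V : E →ₗᵢ[𝕜] E) (W : Submodule 𝕜 E) : Prop :=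
  ∀ x, x ∈ W ↔ ∀ z, inner 𝕜 (V z) x = 0

/-- The embedding `x ↦ Vⁿ x` of `W`; for the wandering subspace its ranges are the orthogonal
summands of the shift part of `V`. -/
def woldEmbedding (V : E →ₗᵢ[𝕜] E) (W : Submodule 𝕜 E) (n : ℕ) : W →ₗᵢ[𝕜] E :=
  (V ^ n).comp W.subtypeₗᵢ

/-- The unitary part of the Wold decomposition of `V`: the orthogonal complement of all the
subspaces `Vⁿ W`. -/
def unitaryPart (V : E →ₗᵢ[𝕜] E) (W : Submodule 𝕜 E) : Submodule 𝕜 E :=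
  (⨆ n, LinearMap.range (woldEmbedding V W n).toLinearMap)ᗮ

variable {V : E →ₗᵢ[𝕜] E} {W : Submodule 𝕜 E} {x : E}

theorem woldEmbedding_zero_apply (x : W) : woldEmbedding V W 0 x = x :=
  rfl

theorem woldEmbedding_succ_apply (n : ℕ) (x : W) :
    woldEmbedding V W (n + 1) x = V (woldEmbedding V W n x) := by
  simp only [woldEmbedding, pow_succ']
  rfl

theorem inner_woldEmbedding_add_succ (hW : IsWanderingSubspace V W) (m k : ℕ) (x y : W) :
    inner 𝕜 (woldEmbedding V W (m + k + 1) x) (woldEmbedding V W m y) = 0 := by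
  induction m with
  | zero =>
    rw [woldEmbedding_succ_apply]
    exact (hW y).mp y.2 _
  | succ m ih =>
    rwa [add_right_comm m 1 k, woldEmbedding_succ_apply, woldEmbedding_succ_apply m,
      LinearIsometry.inner_map_map]

theorem orthogonalFamily_woldEmbedding (hW : IsWanderingSubspace V W) :
    OrthogonalFamily 𝕜 (fun _ : ℕ => W) (woldEmbedding V W) := by
  intro i j hij x y
  rcases lt_or_gt_of_ne hij with h | h <;> obtain ⟨k, rfl⟩ := Nat.exists_eq_add_of_lt h
  · exact inner_eq_zero_symm.mp (inner_woldEmbedding_add_succ hW _ _ _ _)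
  · exact inner_woldEmbedding_add_succ hW _ _ _ _

theorem mem_unitaryPart_iff :
    x ∈ unitaryPart V W ↔ ∀ n y, inner 𝕜 (woldEmbedding V W n y) x = 0 := by
  rw [unitaryPart, ← Submodule.iInf_orthogonal, Submodule.mem_iInf]
  exact forall_congr' fun n => by
    rw [Submodule.mem_orthogonal]
    exact Set.forall_mem_range

theorem map_mem_unitaryPart (hW : IsWanderingSubspace V W) (hx : x ∈ unitaryPart V W) :
    V x ∈ unitaryPart V W := by
  refine mem_unitaryPart_iff.mpr fun n y => ?_
  cases n with
  | zero => exact inner_eq_zero_symm.mp ((hW y).mp y.2 x)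
  | succ n =>
    rw [woldEmbedding_succ_apply, LinearIsometry.inner_map_map]
    exact mem_unitaryPart_iff.mp hx n y

theorem map_woldEmbedding_of_commute {B : E →ₗ[𝕜] E} (hBV : ∀ z, B (V z) = V (B z)) (n : ℕ)
    (y : W) (hy : B y ∈ W) : B (woldEmbedding V W n y) = woldEmbedding V W n ⟨B y, hy⟩ := by
  induction n with
  | zero => rfl
  | succ n ih => rw [woldEmbedding_succ_apply, woldEmbedding_succ_apply, hBV, ih]

theorem map_mem_unitaryPart_of_commute (hW : IsWanderingSubspace V W) {B : E →ₗ[𝕜] E}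
    (hB : B.IsSymmetric) (hBV : ∀ z, B (V z) = V (B z)) (hx : x ∈ unitaryPart V W) :
    B x ∈ unitaryPart V W := by
  have hBW : ∀ y ∈ W, B y ∈ W := fun y hy => (hW _).mpr fun z => by
    rw [← hB, hBV]
    exact (hW y).mp hy _
  refine mem_unitaryPart_iff.mpr fun n y => ?_
  rw [← hB, map_woldEmbedding_of_commute hBV n y (hBW y y.2)]
  exact mem_unitaryPart_iff.mp hx n _

variable [CompleteSpace E]

theorem adjoint_mem_unitaryPart (hx : x ∈ unitaryPart V W) :
    ContinuousLinearMap.adjoint V.toContinuousLinearMap x ∈ unitaryPart V W :=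
  mem_unitaryPart_iff.mpr fun n y => by
    rw [ContinuousLinearMap.adjoint_inner_right, LinearIsometry.coe_toContinuousLinearMap,
      ← woldEmbedding_succ_apply]
    exact mem_unitaryPart_iff.mp hx (n + 1) y

theorem apply_adjoint_of_mem_unitaryPart (hW : IsWanderingSubspace V W)
    (hx : x ∈ unitaryPart V W) :
    V (ContinuousLinearMap.adjoint V.toContinuousLinearMap x) = x := by
  have hunitary := sub_mem hx (map_mem_unitaryPart hW (adjoint_mem_unitaryPart hx))
  have hwandering := (hW (x - V (ContinuousLinearMap.adjoint V.toContinuousLinearMap x))).mpr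
    fun z => by
      rw [inner_sub_right, LinearIsometry.inner_map_map, ContinuousLinearMap.adjoint_inner_right,
        LinearIsometry.coe_toContinuousLinearMap, sub_self]
  have horth := mem_unitaryPart_iff.mp hunitary 0 ⟨_, hwandering⟩
  rw [woldEmbedding_zero_apply] at horth
  exact (sub_eq_zero.mp (inner_self_eq_zero.mp horth)).symm

theorem isStarNormal_restrict {T : E →L[𝕜] E} {M : Submodule 𝕜 E} [CompleteSpace M]
    (hT : Set.MapsTo T M M) (hTadj : Set.MapsTo (ContinuousLinearMap.adjoint T) M M)
    (hnorm : ∀ x ∈ M, ‖T x‖ = ‖ContinuousLinearMap.adjoint T x‖) :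
    IsStarNormal (T.restrict hT) := by
  have hadj : ContinuousLinearMap.adjoint (T.restrict hT) =
      (ContinuousLinearMap.adjoint T).restrict hTadj := by
    refine ((ContinuousLinearMap.eq_adjoint_iff _ _).mpr fun x y => ?_).symm
    exact ContinuousLinearMap.adjoint_inner_left T (y : E) (x : E)
  rw [ContinuousLinearMap.isStarNormal_iff_norm_eq_adjoint, hadj]
  exact fun x => hnorm x x.2

end Wold

section PureQuasinormal

variable {H : Type u} [NormedAddCommGroup H] [InnerProductSpace ℂ H] [CompleteSpace H]
  {T : H →L[ℂ] H}

theorem denseRange_abs (hT : IsPureQuasinormal T) : DenseRange (CFC.abs T : H →L[ℂ] H) := by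
  have hker : LinearMap.ker (CFC.abs T).toLinearMap = ⊥ := by
    refine (Submodule.eq_bot_iff _).mpr fun x hx => ?_
    have hTx : T x = 0 := by
      rw [← norm_eq_zero, ← norm_abs_apply, norm_eq_zero]
      exact hx
    exact (Submodule.eq_bot_iff _).mp (ker_eq_bot T hT) x hTx
  have hdense : (LinearMap.range (CFC.abs T).toLinearMap).topologicalClosure = ⊤ := by
    rw [Submodule.topologicalClosure_eq_top_iff]
    exact ContinuousLinearMap.IsStarNormal.orthogonal_range (abs_isSelfAdjoint T).isStarNormal
      |>.trans hker
  exact Submodule.dense_iff_topologicalClosure_eq_top.mpr hdense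

/-- The partial isometry `V_T` of a pure quasinormal operator, which is an isometry because `|T|`
has dense range. -/
def polarLinearIsometry (hT : IsPureQuasinormal T) : H →ₗᵢ[ℂ] H where
  toLinearMap := (polarIsometry T).toLinearMap
  norm_map' x := (denseRange_abs hT).induction_on (p := fun x => ‖polarIsometry T x‖ = ‖x‖) x
    (isClosed_eq (by fun_prop) (by fun_prop)) fun z => by rw [polarIsometry_abs, norm_abs_apply]

theorem polarLinearIsometry_abs (hT : IsPureQuasinormal T) (x : H) :
    polarLinearIsometry hT (CFC.abs T x) = T x :=
  polarIsometry_abs T x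

theorem abs_polarLinearIsometry (hT : IsPureQuasinormal T) (x : H) :
    CFC.abs T (polarLinearIsometry hT x) = polarLinearIsometry hT (CFC.abs T x) :=
  (polarIsometry_commute T hT.quasinormal x).symm

theorem isWanderingSubspace_defectSpace (hT : IsPureQuasinormal T) :
    IsWanderingSubspace (polarLinearIsometry hT) (defectSpace T) := fun x => by
  rw [defectSpace, Submodule.mem_orthogonal]
  exact Set.forall_mem_range

theorem adjoint_eq_abs_adjoint_polarLinearIsometry (hT : IsPureQuasinormal T) (x : H) :
    ContinuousLinearMap.adjoint T x = CFC.abs T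
      (ContinuousLinearMap.adjoint (polarLinearIsometry hT).toContinuousLinearMap x) := by
  refine ext_inner_left ℂ fun w => ?_
  rw [ContinuousLinearMap.adjoint_inner_right, ← inner_abs_left,
    ContinuousLinearMap.adjoint_inner_right, LinearIsometry.coe_toContinuousLinearMap,
    polarLinearIsometry_abs]

theorem unitaryPart_polarLinearIsometry_eq_bot (hT : IsPureQuasinormal T) :
    unitaryPart (polarLinearIsometry hT) (defectSpace T) = ⊥ := by
  have hW := isWanderingSubspace_defectSpace hT
  set V := polarLinearIsometry hT
  set M := unitaryPart V (defectSpace T)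
  have : CompleteSpace M := (Submodule.isClosed_orthogonal _).completeSpace_coe
  have habs : ∀ x ∈ M, CFC.abs T x ∈ M := fun x hx =>
    map_mem_unitaryPart_of_commute hW (B := (CFC.abs T).toLinearMap) (inner_abs_left T)
      (abs_polarLinearIsometry hT) hx
  have hmaps : Set.MapsTo T M M := fun x hx => by
    rw [← polarLinearIsometry_abs hT]
    exact map_mem_unitaryPart hW (habs x hx)
  have hmaps_adj : Set.MapsTo (ContinuousLinearMap.adjoint T) M M := fun x hx => by
    rw [adjoint_eq_abs_adjoint_polarLinearIsometry hT]
    exact habs _ (adjoint_mem_unitaryPart hx)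
  refine hT.pure M hmaps hmaps_adj (isStarNormal_restrict hmaps hmaps_adj fun x hx => ?_)
  set x' := ContinuousLinearMap.adjoint V.toContinuousLinearMap x
  calc ‖T x‖ = ‖CFC.abs T (V x')‖ := by
        rw [apply_adjoint_of_mem_unitaryPart hW hx, norm_abs_apply]
    _ = ‖CFC.abs T x'‖ := by rw [abs_polarLinearIsometry, LinearIsometry.norm_map]
    _ = ‖ContinuousLinearMap.adjoint T x‖ := by
        rw [adjoint_eq_abs_adjoint_polarLinearIsometry hT]

theorem isHilbertSum_woldEmbedding_polarLinearIsometry (hT : IsPureQuasinormal T) :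
    IsHilbertSum ℂ (fun _ : ℕ => defectSpace T)
      (woldEmbedding (polarLinearIsometry hT) (defectSpace T)) :=
  IsHilbertSum.mk (orthogonalFamily_woldEmbedding (isWanderingSubspace_defectSpace hT))
    (Submodule.topologicalClosure_eq_top_iff.mpr (unitaryPart_polarLinearIsometry_eq_bot hT)).ge

theorem apply_woldEmbedding_polarLinearIsometry (hT : IsPureQuasinormal T) (n : ℕ)
    (x : defectSpace T) :
    T (woldEmbedding (polarLinearIsometry hT) (defectSpace T) n x) =
      woldEmbedding (polarLinearIsometry hT) (defectSpace T) (n + 1) (defectOp T hT x) := by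
  rw [woldEmbedding_succ_apply, ← polarLinearIsometry_abs hT]
  exact congrArg _ (map_woldEmbedding_of_commute (B := (CFC.abs T).toLinearMap)
    (abs_polarLinearIsometry hT) n x (defectOp T hT x).2)

end PureQuasinormal

section Coordinates

variable {K : Type u} [NormedAddCommGroup K] [InnerProductSpace ℂ K]

@[simp]
theorem shift_apply_zero (f : HardyTensor K) : shift K f 0 = 0 :=
  rfl

@[simp]
theorem shift_apply_succ (f : HardyTensor K) (i : ℕ) : shift K f (i + 1) = f i :=
  rfl

@[simp]
theorem diag_apply (X : ℕ → K →L[ℂ] K) (hX : ∃ C, ∀ n, ‖X n‖ ≤ C) (f : HardyTensor K) (i : ℕ) :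
    diag X hX f i = X i (f i) :=
  rfl

@[simp]
theorem tensorShift_apply_zero (A : K →L[ℂ] K) (f : HardyTensor K) : tensorShift A f 0 = 0 :=
  map_zero A

@[simp]
theorem tensorShift_apply_succ (A : K →L[ℂ] K) (f : HardyTensor K) (n : ℕ) :
    tensorShift A f (n + 1) = A (f n) :=
  rfl

theorem shift_single (j : ℕ) (x : K) : shift K (lp.single 2 j x) = lp.single 2 (j + 1) x := by
  ext i
  cases i <;> simp [lp.single_apply, Pi.single_apply]

theorem shift_pow_single (m j : ℕ) (x : K) :
    (shift K ^ m) (lp.single 2 j x) = lp.single 2 (m + j) x := by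
  induction m with
  | zero => rw [pow_zero, one_apply_eq_self, zero_add]
  | succ m ih => rw [pow_succ', mul_apply_eq_comp, ih, shift_single, Nat.add_right_comm]

theorem diag_single (X : ℕ → K →L[ℂ] K) (hX : ∃ C, ∀ n, ‖X n‖ ≤ C) (j : ℕ) (x : K) :
    diag X hX (lp.single 2 j x) = lp.single 2 j (X j x) := by
  ext i
  rw [diag_apply]
  rcases eq_or_ne i j with rfl | hij
  · rw [lp.single_apply_self, lp.single_apply_self]
  · rw [lp.single_apply_ne _ _ _ hij, lp.single_apply_ne _ _ _ hij, map_zero]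

theorem tensorShift_single (A : K →L[ℂ] K) (j : ℕ) (x : K) :
    tensorShift A (lp.single 2 j x) = lp.single 2 (j + 1) (A x) := by
  rw [tensorShift, ContinuousLinearMap.comp_apply, shift_single, diag_single]

theorem tensorShift_commute_shift (A : K →L[ℂ] K) : Commute (tensorShift A) (shift K) := by
  refine ContinuousLinearMap.ext fun f => ?_
  ext i
  rw [mul_apply_eq_comp, mul_apply_eq_comp]
  rcases i with _ | _ | i <;> simp

end Coordinates

theorem exists_isModelUnitary {H : Type u} [NormedAddCommGroup H] [InnerProductSpace ℂ H]
    [CompleteSpace H] {T : H →L[ℂ] H} (hT : IsPureQuasinormal T) :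
    ∃ U : H ≃ₗᵢ[ℂ] HardyTensor (defectSpace T), IsModelUnitary T hT U := by
  have hsum := isHilbertSum_woldEmbedding_polarLinearIsometry hT
  refine ⟨hsum.linearIsometryEquiv, fun f => ?_⟩
  rw [← LinearIsometryEquiv.eq_symm_apply]
  have himage := (hsum.hasSum_linearIsometryEquiv_symm f).mapL T
  have hshift := hsum.hasSum_linearIsometryEquiv_symm (tensorShift (defectOp T hT) f)
  rw [← hasSum_nat_add_iff' 1] at hshift
  simp only [Finset.sum_range_one, tensorShift_apply_zero, map_zero, sub_zero,
    tensorShift_apply_succ, ← apply_woldEmbedding_polarLinearIsometry] at hshift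
  exact himage.unique hshift

section WeakStar

open Filter Topology

variable {E : Type u} {F : Type v} [NormedAddCommGroup E] [InnerProductSpace ℂ E]
  [NormedAddCommGroup F] [InnerProductSpace ℂ F]

theorem continuous_weakStar_tsum_inner (x y : lp (fun _ : ℕ => E) 2) :
    Continuous[weakStarTopology E, _] fun X : E →L[ℂ] E => ∑' n, ⟪y n, X (x n)⟫_ℂ :=
  continuous_iff_le_induced.mpr (iInf_le_of_le x (iInf_le _ y))

theorem continuous_weakStar_inner (x y : E) :
    Continuous[weakStarTopology E, _] fun X : E →L[ℂ] E => ⟪y, X x⟫_ℂ := by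
  convert continuous_weakStar_tsum_inner (lp.single 2 0 x) (lp.single 2 0 y) using 2 with X
  rw [tsum_eq_single 0 fun n hn => by rw [lp.single_apply_ne _ _ _ hn, inner_zero_left],
    lp.single_apply_self, lp.single_apply_self]

theorem memℓp_comp_clm (C : E →L[ℂ] F) (x : lp (fun _ : ℕ => E) 2) :
    Memℓp (fun n => C (x n)) 2 := by
  refine ((lp.memℓp x).norm.const_mul ‖C‖).mono fun n => ?_
  exact C.le_opNorm (x n)

theorem continuous_weakStar_comp [CompleteSpace E] [CompleteSpace F] (B : E →L[ℂ] F)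
    (A : F →L[ℂ] E) :
    Continuous[weakStarTopology E, weakStarTopology F] fun X : E →L[ℂ] E => B ∘L X ∘L A := by
  let := weakStarTopology E
  refine continuous_iInf_rng.mpr fun x => continuous_iInf_rng.mpr fun y =>
    continuous_induced_rng.mpr ?_
  refine (continuous_weakStar_tsum_inner ⟨_, memℓp_comp_clm A x⟩
    ⟨_, memℓp_comp_clm (ContinuousLinearMap.adjoint B) y⟩).congr fun X => ?_
  exact tsum_congr fun n => ContinuousLinearMap.adjoint_inner_left B _ _

theorem weakStarSpan_image_conj [CompleteSpace E] [CompleteSpace F] (e : E ≃L[ℂ] F)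
    (s : Set (E →L[ℂ] E)) :
    weakStarSpan (e.conjContinuousAlgEquiv '' s) = e.conjContinuousAlgEquiv '' weakStarSpan s := by
  have hspan : (Submodule.span ℂ (e.conjContinuousAlgEquiv '' s) : Set (F →L[ℂ] F)) =
      e.conjContinuousAlgEquiv '' Submodule.span ℂ s :=
    congrArg SetLike.coe (Submodule.span_image e.conjContinuousAlgEquiv.toLinearEquiv.toLinearMap)
  let := weakStarTopology E
  let := weakStarTopology F
  let conj : (E →L[ℂ] E) ≃ₜ (F →L[ℂ] F) :=
    { toEquiv := e.conjContinuousAlgEquiv.toEquiv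
      continuous_toFun := continuous_weakStar_comp (e : E →L[ℂ] F) (e.symm : F →L[ℂ] E)
      continuous_invFun := continuous_weakStar_comp (e.symm : F →L[ℂ] E) (e : E →L[ℂ] F) }
  rw [weakStarSpan, hspan]
  exact (conj.image_closure _).symm

theorem tendsto_weakStar_of_bounded {ι : Type*} {l : Filter ι} [l.IsCountablyGenerated]
    {X : ι → E →L[ℂ] E} {Y : E →L[ℂ] E} {C : ℝ}
    (hC : ∀ i, ‖X i‖ ≤ C) (h : ∀ x y : E, Tendsto (fun i => ⟪y, X i x⟫_ℂ) l (𝓝 ⟪y, Y x⟫_ℂ)) :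
    Tendsto X l (@nhds _ (weakStarTopology E) Y) := by
  simp only [nhds_iInf, tendsto_iInf, nhds_induced, tendsto_comap_iff]
  intro x y
  have hsummable : Summable fun n => C * (‖x n‖ * ‖y n‖) :=
    (lp.summable_mul (by rw [Real.holderConjugate_iff]; norm_num) x y).mul_left C
  refine tendsto_tsum_of_dominated_convergence hsummable (fun n => h (x n) (y n))
    (Eventually.of_forall fun i n => ?_)
  calc ‖⟪y n, X i (x n)⟫_ℂ‖ ≤ ‖y n‖ * ‖X i (x n)‖ := norm_inner_le_norm _ _
    _ ≤ ‖y n‖ * (C * ‖x n‖) := by gcongr; exact (X i).le_of_opNorm_le (hC i) _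
    _ = C * (‖x n‖ * ‖y n‖) := by ring

end WeakStar

section ExtEigenspace

variable {E : Type u} {F : Type v} [NormedAddCommGroup E] [InnerProductSpace ℂ E]
  [NormedAddCommGroup F] [InnerProductSpace ℂ F] {T X : E →L[ℂ] E} {lam : ℂ}

theorem mem_extEigenspace : X ∈ extEigenspace T lam ↔ T ∘L X = lam • (X ∘L T) := by
  refine ⟨fun h => ?_, fun h => ?_⟩
  · induction h using Submodule.span_induction with
    | mem X hX => exact hX.2
    | zero => simp
    | add X Y _ _ hX hY =>
      rw [ContinuousLinearMap.comp_add, ContinuousLinearMap.add_comp, hX, hY, smul_add]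
    | smul c X _ hX =>
      rw [ContinuousLinearMap.comp_smul, ContinuousLinearMap.smul_comp, hX, smul_comm]
  · by_cases hX : X = 0
    · exact hX ▸ zero_mem _
    · exact Submodule.subset_span ⟨hX, h⟩

theorem mem_extEigenspace_iff_apply :
    X ∈ extEigenspace T lam ↔ ∀ x, T (X x) = lam • X (T x) :=
  mem_extEigenspace.trans ContinuousLinearMap.ext_iff

theorem extEigenspace_conj (e : E ≃L[ℂ] F) (T : E →L[ℂ] E) (lam : ℂ) :
    (extEigenspace (e.conjContinuousAlgEquiv T) lam : Set (F →L[ℂ] F)) =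
      e.conjContinuousAlgEquiv '' extEigenspace T lam := by
  have hinj := EquivLike.injective e.conjContinuousAlgEquiv
  ext Y
  obtain ⟨X, rfl⟩ := EquivLike.surjective e.conjContinuousAlgEquiv Y
  rw [hinj.mem_set_image, SetLike.mem_coe, SetLike.mem_coe, mem_extEigenspace,
    mem_extEigenspace, ← hinj.eq_iff, ← ContinuousLinearMap.mul_def,
    ← ContinuousLinearMap.mul_def, ← ContinuousLinearMap.mul_def, ← ContinuousLinearMap.mul_def,
    map_mul, map_smul, map_mul]

theorem comp_mem_extEigenspace {B : E →L[ℂ] E} (hB : Commute T B) (hX : X ∈ extEigenspace T lam) :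
    B ∘L X ∈ extEigenspace T lam := by
  refine mem_extEigenspace_iff_apply.mpr fun x => ?_
  rw [ContinuousLinearMap.comp_apply, ContinuousLinearMap.comp_apply, ← map_smul,
    ← mem_extEigenspace_iff_apply.mp hX]
  exact congrArg (fun Z : E →L[ℂ] E => Z (X x)) hB.eq

theorem isClosed_weakStar_extEigenspace [CompleteSpace E] (T : E →L[ℂ] E) (lam : ℂ) :
    @IsClosed _ (weakStarTopology E) (extEigenspace T lam : Set (E →L[ℂ] E)) := by
  let := weakStarTopology E
  have hinter : (extEigenspace T lam : Set (E →L[ℂ] E)) = ⋂ (x : E) (y : E),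
      {X | ⟪ContinuousLinearMap.adjoint T y, X x⟫_ℂ = lam * ⟪y, X (T x)⟫_ℂ} := by
    ext X
    simp only [SetLike.mem_coe, mem_extEigenspace_iff_apply, Set.mem_iInter, Set.mem_ofPred_eq,
      ContinuousLinearMap.adjoint_inner_left, ← inner_smul_right]
    exact forall_congr' fun x => ⟨fun h y => by rw [h], ext_inner_left ℂ⟩
  rw [hinter]
  exact isClosed_iInter fun x => isClosed_iInter fun y => isClosed_eq
    (continuous_weakStar_inner _ _) (continuous_const.mul (continuous_weakStar_inner _ _))

theorem weakStarSpan_subset_extEigenspace [CompleteSpace E] {s : Set (E →L[ℂ] E)}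
    (hs : s ⊆ extEigenspace T lam) : weakStarSpan s ⊆ extEigenspace T lam := by
  let := weakStarTopology E
  exact closure_minimal (Submodule.span_le.mpr hs) (isClosed_weakStar_extEigenspace T lam)

theorem ne_zero_of_mem_extSpectrum [CompleteSpace E] (hT : IsPureQuasinormal T)
    (hlam : lam ∈ extSpectrum T) : lam ≠ 0 := by
  rintro rfl
  obtain ⟨X, hX_ne, hX⟩ := hlam
  refine hX_ne (ContinuousLinearMap.ext fun x => ?_)
  have hker : X x ∈ LinearMap.ker T.toLinearMap := by
    rw [zero_smul] at hX
    exact congrArg (fun Z : E →L[ℂ] E => Z x) hX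
  rwa [ker_eq_bot T hT, Submodule.mem_bot] at hker

end ExtEigenspace

section Matrix

variable {K : Type u} [NormedAddCommGroup K] [InnerProductSpace ℂ K]

/-- The entry of index `(i, j)` of the operator matrix of `Y`. -/
def entry (Y : HardyTensor K →L[ℂ] HardyTensor K) (i j : ℕ) : K →L[ℂ] K :=
  lp.evalCLM ℂ (fun _ : ℕ => K) 2 i ∘L Y ∘L lp.singleContinuousLinearMap ℂ (fun _ : ℕ => K) 2 j

theorem entry_apply (Y : HardyTensor K →L[ℂ] HardyTensor K) (i j : ℕ) (x : K) :
    entry Y i j x = Y (lp.single 2 j x) i :=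
  rfl

theorem norm_entry_le (Y : HardyTensor K →L[ℂ] HardyTensor K) (i j : ℕ) : ‖entry Y i j‖ ≤ ‖Y‖ := by
  refine ContinuousLinearMap.opNorm_le_bound _ (norm_nonneg Y) fun x => ?_
  calc ‖entry Y i j x‖ ≤ ‖Y (lp.single 2 j x)‖ := lp.norm_apply_le_norm two_ne_zero _ i
    _ ≤ ‖Y‖ * ‖(lp.single 2 j x : HardyTensor K)‖ := Y.le_opNorm _
    _ = ‖Y‖ * ‖x‖ := by rw [lp.norm_single two_pos]

theorem entry_sum {ι : Type*} (s : Finset ι) (Y : ι → HardyTensor K →L[ℂ] HardyTensor K)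
    (i j : ℕ) : entry (∑ k ∈ s, Y k) i j = ∑ k ∈ s, entry (Y k) i j := by
  ext x
  simp only [entry_apply, sum_apply, lp.coeFn_sum, Finset.sum_apply]

theorem entry_smul (c : ℂ) (Y : HardyTensor K →L[ℂ] HardyTensor K) (i j : ℕ) :
    entry (c • Y) i j = c • entry Y i j :=
  rfl

theorem apply_eq_of_entry_eq {Y Z : HardyTensor K →L[ℂ] HardyTensor K} {i : ℕ}
    (h : ∀ j, entry Y i j = entry Z i j) (f : HardyTensor K) : Y f i = Z f i := by
  have hrow : lp.evalCLM ℂ (fun _ : ℕ => K) 2 i ∘L Y = lp.evalCLM ℂ (fun _ : ℕ => K) 2 i ∘L Z :=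
    lp.ext_continuousLinearMap ENNReal.ofNat_ne_top h
  exact congrArg (fun R : HardyTensor K →L[ℂ] K => R f) hrow

/-- `Y` has a lower triangular operator matrix. -/
def IsLowerTriangular (Y : HardyTensor K →L[ℂ] HardyTensor K) : Prop :=
  ∀ i j, i < j → entry Y i j = 0

theorem IsLowerTriangular.apply_eq_sum_entry {Y : HardyTensor K →L[ℂ] HardyTensor K}
    (hY : IsLowerTriangular Y) (f : HardyTensor K) (i : ℕ) :
    Y f i = ∑ j ∈ Finset.range (i + 1), entry Y i j (f j) := by
  have hsum : HasSum (fun j => entry Y i j (f j)) (Y f i) :=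
    (lp.hasSum_single ENNReal.ofNat_ne_top f).mapL (lp.evalCLM ℂ (fun _ : ℕ => K) 2 i ∘L Y)
  refine hsum.unique (hasSum_sum_of_ne_finset_zero fun j hj => ?_)
  rw [hY i j (by simpa using hj), zero_apply]

end Matrix

section Fejer

open Filter Topology

variable {K : Type u} [NormedAddCommGroup K] [InnerProductSpace ℂ K]
  {Y : HardyTensor K →L[ℂ] HardyTensor K}

/-- The `m`-th diagonal of `Y` below the main one, moved up to the main diagonal. -/
def lowerDiagonal (Y : HardyTensor K →L[ℂ] HardyTensor K) (m : ℕ) :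
    HardyTensor K →L[ℂ] HardyTensor K :=
  diag (fun j => entry Y (m + j) j) ⟨‖Y‖, fun j => norm_entry_le Y (m + j) j⟩

/-- The Fejér (Cesàro) mean of order `N` of the expansion `∑ₘ (I ⊗ Sᵐ) lowerDiagonal Y m` of a
lower triangular `Y`. -/
def fejerMean (Y : HardyTensor K →L[ℂ] HardyTensor K) (N : ℕ) :
    HardyTensor K →L[ℂ] HardyTensor K :=
  ∑ m ∈ Finset.range N, (((N - m : ℕ) : ℂ) / N) • ((shift K ^ m) ∘L lowerDiagonal Y m)

theorem entry_shift_pow_comp_lowerDiagonal (hY : IsLowerTriangular Y) (m i j : ℕ) :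
    entry ((shift K ^ m) ∘L lowerDiagonal Y m) i j = if m = i - j then entry Y i j else 0 := by
  ext x
  rw [entry_apply, ContinuousLinearMap.comp_apply, lowerDiagonal, diag_single, shift_pow_single]
  rcases lt_or_ge i j with hij | hij
  · rw [lp.single_apply_ne _ _ _ (by omega), hY i j hij, ite_self, zero_apply]
  · split_ifs with hm
    · obtain rfl : i = m + j := by omega
      rw [lp.single_apply_self]
    · rw [lp.single_apply_ne _ _ _ (by omega), zero_apply]

theorem entry_fejerMean (hY : IsLowerTriangular Y) (N i j : ℕ) :
    entry (fejerMean Y N) i j = (((N - (i - j) : ℕ) : ℂ) / N) • entry Y i j := by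
  simp only [fejerMean, entry_sum, entry_smul, entry_shift_pow_comp_lowerDiagonal hY, smul_ite,
    smul_zero, Finset.sum_ite_eq', Finset.mem_range, ite_eq_left_iff, not_lt]
  intro h
  rw [Nat.sub_eq_zero_of_le h, Nat.cast_zero, zero_div, zero_smul]

/-- The projection of `⊕ K` onto the sequences supported on the indices `k - N < j ≤ k`, the
condition on `j` being written so as to avoid truncated subtraction. -/
def window (K : Type u) [NormedAddCommGroup K] [InnerProductSpace ℂ K] (N k : ℕ) :
    HardyTensor K →L[ℂ] HardyTensor K :=
  diag (fun j => if k ∈ Finset.Ico j (j + N) then ContinuousLinearMap.id ℂ K else 0)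
    ⟨1, fun j => by
      split_ifs
      · exact ContinuousLinearMap.norm_id_le
      · exact norm_zero.trans_le zero_le_one⟩

theorem window_apply (N k : ℕ) (f : HardyTensor K) (j : ℕ) :
    window K N k f j = if k ∈ Finset.Ico j (j + N) then f j else 0 := by
  rw [window, diag_apply]
  split_ifs <;> rfl

theorem window_single (N k j : ℕ) (x : K) :
    window K N k (lp.single 2 j x) =
      if k ∈ Finset.Ico j (j + N) then lp.single 2 j x else 0 := by
  rw [window, diag_single]
  split_ifs
  · rfl
  · exact lp.single_zero 2 j

theorem window_isSymmetric (N k : ℕ) : (window K N k).IsSymmetric := by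
  intro f g
  refine tsum_congr fun j => ?_
  change ⟪window K N k f j, g j⟫_ℂ = ⟪f j, window K N k g j⟫_ℂ
  rw [window_apply, window_apply]
  split_ifs
  · rfl
  · rw [inner_zero_left, inner_zero_right]

theorem sum_norm_sq_window_le (N : ℕ) (s : Finset ℕ) (f : HardyTensor K) :
    ∑ k ∈ s, ‖window K N k f‖ ^ 2 ≤ N * ‖f‖ ^ 2 := by
  have hnorm (g : HardyTensor K) : HasSum (fun j => ‖g j‖ ^ 2) (‖g‖ ^ 2) := by
    simpa using lp.hasSum_norm (p := 2) (by norm_num) g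
  refine hasSum_le (fun j => ?_) (hasSum_sum fun k (_ : k ∈ s) => hnorm (window K N k f))
    ((hnorm f).mul_left (N : ℝ))
  have hterm (k : ℕ) :
      ‖window K N k f j‖ ^ 2 = if k ∈ Finset.Ico j (j + N) then ‖f j‖ ^ 2 else 0 := by
    rw [window_apply]
    split_ifs <;> simp
  calc ∑ k ∈ s, ‖window K N k f j‖ ^ 2
      = (s ∩ Finset.Ico j (j + N)).card * ‖f j‖ ^ 2 := by
        rw [Finset.sum_congr rfl fun k _ => hterm k, Finset.sum_ite_mem, Finset.sum_const,
          nsmul_eq_mul]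
    _ ≤ (Finset.Ico j (j + N)).card * ‖f j‖ ^ 2 := by
        gcongr
        exact Finset.inter_subset_right
    _ = N * ‖f j‖ ^ 2 := by rw [Nat.card_Ico, Nat.add_sub_cancel_left]

theorem norm_sum_compression_le {𝕜 E ι : Type*} [RCLike 𝕜] [NormedAddCommGroup E]
    [InnerProductSpace 𝕜 E] {s : Finset ι} {Q : ι → E →L[𝕜] E} {a : ℝ} (ha : 0 ≤ a)
    (hsymm : ∀ k, (Q k).IsSymmetric) (hQ : ∀ x, ∑ k ∈ s, ‖Q k x‖ ^ 2 ≤ a * ‖x‖ ^ 2)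
    (Y : E →L[𝕜] E) : ‖∑ k ∈ s, Q k ∘L Y ∘L Q k‖ ≤ a * ‖Y‖ := by
  refine ContinuousLinearMap.opNorm_le_of_re_inner_le (by positivity) fun x y hx hy => ?_
  have hunit (z : E) (hz : ‖z‖ = 1) : ∑ k ∈ s, ‖Q k z‖ ^ 2 ≤ a :=
    (hQ z).trans_eq (by rw [hz, one_pow, mul_one])
  rw [sum_apply, sum_inner, map_sum]
  calc ∑ k ∈ s, RCLike.re (inner 𝕜 (Q k (Y (Q k x))) y)
      ≤ ∑ k ∈ s, ‖Y‖ * (‖Q k x‖ * ‖Q k y‖) := by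
        refine Finset.sum_le_sum fun k _ => ?_
        rw [(hsymm k).apply_clm (Y (Q k x)) y, ← mul_assoc]
        exact (re_inner_le_norm _ _).trans (by gcongr; exact Y.le_opNorm _)
    _ = ‖Y‖ * ∑ k ∈ s, ‖Q k x‖ * ‖Q k y‖ := (Finset.mul_sum _ _ _).symm
    _ ≤ ‖Y‖ * (√(∑ k ∈ s, ‖Q k x‖ ^ 2) * √(∑ k ∈ s, ‖Q k y‖ ^ 2)) := by
        gcongr
        exact Real.sum_mul_le_sqrt_mul_sqrt s _ _
    _ ≤ ‖Y‖ * (√a * √a) := by gcongr; exacts [hunit x hx, hunit y hy]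
    _ = a * ‖Y‖ := by rw [Real.mul_self_sqrt ha, mul_comm]

theorem entry_window_comp_comp_window (Y : HardyTensor K →L[ℂ] HardyTensor K) (N k i j : ℕ) :
    entry (window K N k ∘L Y ∘L window K N k) i j =
      if k ∈ Finset.Ico i (i + N) ∩ Finset.Ico j (j + N) then entry Y i j else 0 := by
  ext x
  rw [entry_apply, ContinuousLinearMap.comp_apply, ContinuousLinearMap.comp_apply, window_apply,
    window_single]
  by_cases hi : k ∈ Finset.Ico i (i + N)
  · by_cases hj : k ∈ Finset.Ico j (j + N)
    · rw [if_pos hi, if_pos hj, if_pos (Finset.mem_inter_of_mem hi hj), entry_apply]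
    · rw [if_pos hi, if_neg hj, if_neg fun h => hj (Finset.mem_inter.mp h).2, map_zero]
      rfl
  · rw [if_neg hi, if_neg fun h => hi (Finset.mem_inter.mp h).1, zero_apply]

theorem entry_sum_window_comp_comp_window (hY : IsLowerTriangular Y) {N M i : ℕ}
    (hM : i + N ≤ M) (j : ℕ) :
    entry (∑ k ∈ Finset.range M, window K N k ∘L Y ∘L window K N k) i j =
      ((N - (i - j) : ℕ) : ℂ) • entry Y i j := by
  rcases lt_or_ge i j with hij | hij
  · simp only [entry_sum, entry_window_comp_comp_window, hY i j hij, ite_self,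
      Finset.sum_const_zero, smul_zero]
  have hinter : Finset.range M ∩ (Finset.Ico i (i + N) ∩ Finset.Ico j (j + N)) =
      Finset.Ico i (j + N) := by
    ext k
    simp only [Finset.mem_inter, Finset.mem_range, Finset.mem_Ico]
    omega
  rw [entry_sum, Finset.sum_congr rfl fun k _ => entry_window_comp_comp_window Y N k i j,
    Finset.sum_ite_mem, hinter, Finset.sum_const, Nat.card_Ico, Nat.cast_smul_eq_nsmul]
  congr 1
  omega

theorem norm_fejerMean_le (hY : IsLowerTriangular Y) (N : ℕ) : ‖fejerMean Y N‖ ≤ ‖Y‖ := by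
  rcases N.eq_zero_or_pos with rfl | hN
  · exact ContinuousLinearMap.opNorm_zero.trans_le (norm_nonneg Y)
  have hN' : (N : ℂ) ≠ 0 := Nat.cast_ne_zero.mpr hN.ne'
  let G (M : ℕ) := ∑ k ∈ Finset.range M, window K N k ∘L Y ∘L window K N k
  have hG (M : ℕ) : ‖G M‖ ≤ N * ‖Y‖ := norm_sum_compression_le N.cast_nonneg
    (window_isSymmetric N) (sum_norm_sq_window_le N (Finset.range M)) Y
  have hcoord (f : HardyTensor K) (i : ℕ) :
      ∀ᶠ M in atTop, G M f i = ((N : ℂ) • fejerMean Y N) f i := by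
    filter_upwards [eventually_ge_atTop (i + N)] with M hM
    refine apply_eq_of_entry_eq (fun j => ?_) f
    rw [entry_sum_window_comp_comp_window hY hM, entry_smul, entry_fejerMean hY, smul_smul,
      mul_div_cancel₀ _ hN']
  refine ContinuousLinearMap.opNorm_le_bound _ (norm_nonneg Y) fun f => ?_
  have hle : ‖(N : ℂ) • fejerMean Y N f‖ ≤ N * ‖Y‖ * ‖f‖ := by
    refine lp.norm_le_of_tendsto (l := atTop) (F := fun M => G M f)
      (Eventually.of_forall fun M => (G M).le_of_opNorm_le (hG M) f) ?_
    exact tendsto_pi_nhds.mpr fun i => tendsto_const_nhds.congr' (EventuallyEq.symm (hcoord f i))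
  rw [norm_smul, Complex.norm_natCast, mul_assoc] at hle
  exact le_of_mul_le_mul_left hle (Nat.cast_pos.mpr hN)

theorem IsLowerTriangular.fejerMean (hY : IsLowerTriangular Y) (N : ℕ) :
    IsLowerTriangular (fejerMean Y N) := fun i j hij => by
  rw [entry_fejerMean hY, hY i j hij, smul_zero]

theorem tendsto_natCast_sub_div (m : ℕ) :
    Tendsto (fun N : ℕ => ((N - m : ℕ) : ℂ) / N) atTop (𝓝 1) := by
  have hlim : Tendsto (fun N : ℕ => (1 : ℂ) - m / N) atTop (𝓝 (1 - 0)) :=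
    tendsto_const_nhds.sub (tendsto_const_div_atTop_nhds_zero_nat (m : ℂ))
  rw [sub_zero] at hlim
  refine hlim.congr' ?_
  filter_upwards [eventually_gt_atTop m] with N hN
  have hN' : (N : ℂ) ≠ 0 := Nat.cast_ne_zero.mpr (by omega)
  rw [Nat.cast_sub hN.le, sub_div, div_self hN']

theorem tendsto_fejerMean_apply (hY : IsLowerTriangular Y) (f : HardyTensor K) (i : ℕ) :
    Tendsto (fun N => fejerMean Y N f i) atTop (𝓝 (Y f i)) := by
  simp only [hY.apply_eq_sum_entry, (hY.fejerMean _).apply_eq_sum_entry, entry_fejerMean hY]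
  refine tendsto_finsetSum _ fun j _ => ?_
  simpa using (tendsto_natCast_sub_div (i - j)).smul_const (entry Y i j (f j))

theorem tendsto_inner_of_tendsto_coord {ι : Type*} {l : Filter ι} {h : ι → HardyTensor K}
    {h₀ : HardyTensor K} {C : ℝ} (hC : ∀ k, ‖h k‖ ≤ C)
    (hh : ∀ i, Tendsto (fun k => h k i) l (𝓝 (h₀ i))) (g : HardyTensor K) :
    Tendsto (fun k => ⟪g, h k⟫_ℂ) l (𝓝 ⟪g, h₀⟫_ℂ) := by
  have hequi : Equicontinuous fun k (g : HardyTensor K) => ⟪g, h k⟫_ℂ := by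
    refine (Metric.uniformEquicontinuous_of_continuity_modulus
      (fun t => t * C) ?_ _ ?_).equicontinuous
    · exact (continuous_mul_const C).tendsto' 0 0 (zero_mul C)
    · intro f g k
      rw [dist_eq_norm, dist_eq_norm, ← inner_sub_left]
      exact (norm_inner_le_norm _ _).trans (by gcongr; exact hC k)
  have hclosed := hequi.isClosed_setOfPred_tendsto (l := l)
    (show Continuous fun g : HardyTensor K => ⟪g, h₀⟫_ℂ by fun_prop)
  refine hclosed.mem_of_tendsto (lp.hasSum_single ENNReal.ofNat_ne_top g)
    (Eventually.of_forall fun s => ?_)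
  simp only [Set.mem_ofPred_eq, sum_inner, lp.inner_single_left]
  exact tendsto_finsetSum _ fun i _ => tendsto_const_nhds.inner (hh i)

theorem tendsto_weakStar_fejerMean (hY : IsLowerTriangular Y) :
    Tendsto (fejerMean Y) atTop (@nhds _ (weakStarTopology (HardyTensor K)) Y) :=
  tendsto_weakStar_of_bounded (norm_fejerMean_le hY) fun f g =>
    tendsto_inner_of_tendsto_coord
      (fun N => (fejerMean Y N).le_of_opNorm_le (norm_fejerMean_le hY N) f)
      (tendsto_fejerMean_apply hY f) g

end Fejer

section Intertwining

variable {K : Type u} [NormedAddCommGroup K] [InnerProductSpace ℂ K] {A : K →L[ℂ] K} {lam : ℂ}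
  {Y : HardyTensor K →L[ℂ] HardyTensor K}

theorem lam_smul_entry_zero_succ (hY : Y ∈ extEigenspace (tensorShift A) lam) (j : ℕ) (x : K) :
    lam • entry Y 0 (j + 1) (A x) = 0 := by
  have h := mem_extEigenspace_iff_apply.mp hY (lp.single 2 j x)
  rw [tensorShift_single] at h
  exact (congrArg (fun f : HardyTensor K => f 0) h).symm.trans (tensorShift_apply_zero A _)

theorem lam_smul_entry_succ_succ (hY : Y ∈ extEigenspace (tensorShift A) lam) (i j : ℕ) (x : K) :
    lam • entry Y (i + 1) (j + 1) (A x) = A (entry Y i j x) := by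
  have h := mem_extEigenspace_iff_apply.mp hY (lp.single 2 j x)
  rw [tensorShift_single] at h
  exact (congrArg (fun f : HardyTensor K => f (i + 1)) h).symm

theorem isLowerTriangular_of_mem_extEigenspace (hA : DenseRange A) (hlam : lam ≠ 0)
    (hY : Y ∈ extEigenspace (tensorShift A) lam) : IsLowerTriangular Y := by
  have eq_zero (Z : K →L[ℂ] K) (hZ : ∀ x, lam • Z (A x) = 0) : Z = 0 :=
    DFunLike.coe_injective <| hA.equalizer Z.continuous continuous_zero <|
      funext fun x => (smul_eq_zero_iff_right hlam).mp (hZ x)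
  intro i j hij
  induction i generalizing j with
  | zero =>
    obtain ⟨j, rfl⟩ := Nat.exists_eq_succ_of_ne_zero hij.ne'
    exact eq_zero _ (lam_smul_entry_zero_succ hY j)
  | succ i ih =>
    obtain ⟨j, rfl⟩ := Nat.exists_eq_succ_of_ne_zero (Nat.ne_zero_of_lt hij)
    refine eq_zero _ fun x => ?_
    rw [lam_smul_entry_succ_succ hY, ih j (Nat.lt_of_succ_lt_succ hij), zero_apply, map_zero]

theorem entry_add_apply_pow (hlam : lam ≠ 0) (hY : Y ∈ extEigenspace (tensorShift A) lam)
    (m j : ℕ) (x : K) :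
    entry Y (m + j) j ((A ^ j) x) = (lam⁻¹ ^ j) • (A ^ j) (entry Y m 0 x) := by
  induction j with
  | zero => simp
  | succ j ih =>
    rw [pow_succ' A, mul_apply_eq_comp, mul_apply_eq_comp, ← add_assoc, pow_succ', mul_smul,
      ← map_smul A, ← ih, eq_inv_smul_iff₀ hlam, lam_smul_entry_succ_succ hY]

theorem entry_mem_deddens (hlam : lam ≠ 0) (hY : Y ∈ extEigenspace (tensorShift A) lam) (m : ℕ) :
    entry Y m 0 ∈ deddens ‖lam‖ A A := by
  refine ⟨‖Y‖, norm_nonneg Y, fun x n => ?_⟩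
  calc ‖(‖lam‖⁻¹ ^ n) • (A ^ n) (entry Y m 0 x)‖
      = ‖entry Y (m + n) n ((A ^ n) x)‖ := by
        rw [entry_add_apply_pow hlam hY, norm_smul, norm_smul, norm_pow, norm_pow, norm_inv,
          norm_inv, norm_norm]
    _ ≤ ‖Y‖ * ‖(A ^ n) x‖ := (entry Y (m + n) n).le_of_opNorm_le (norm_entry_le Y _ _) _

variable [CompleteSpace K] {L : K →L[ℂ] K}

theorem diagEntry_entry (hA : ∀ n : ℕ, DenseRange (A ^ n : K →L[ℂ] K)) (hlam : lam ≠ 0)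
    (hY : Y ∈ extEigenspace (tensorShift A) lam) (m j : ℕ) :
    diagEntry A lam (entry Y m 0) j = entry Y (m + j) j := by
  refine DFunLike.coe_injective <| (hA j).equalizer (ContinuousLinearMap.continuous _)
    (ContinuousLinearMap.continuous _) <| funext fun x => ?_
  exact (diagEntry_apply hA (entry_mem_deddens hlam hY m) j x).trans
    (entry_add_apply_pow hlam hY m j x).symm

theorem lowerDiagonal_eq_diag_diagEntry (hA : ∀ n : ℕ, DenseRange (A ^ n : K →L[ℂ] K))
    (hlam : lam ≠ 0) (hY : Y ∈ extEigenspace (tensorShift A) lam) (m : ℕ) :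
    lowerDiagonal Y m = diag (diagEntry A lam (entry Y m 0))
      (diagEntry_bounded hA (entry_mem_deddens hlam hY m)) := by
  have hdiag : diagEntry A lam (entry Y m 0) = fun j => entry Y (m + j) j :=
    funext (diagEntry_entry hA hlam hY m)
  simp only [lowerDiagonal, hdiag]

theorem lam_smul_diagEntry_succ_apply (hA : ∀ n : ℕ, DenseRange (A ^ n : K →L[ℂ] K))
    (hlam : lam ≠ 0) (hL : L ∈ deddens ‖lam‖ A A) (n : ℕ) (x : K) :
    lam • diagEntry A lam L (n + 1) (A x) = A (diagEntry A lam L n x) := by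
  refine congrFun ((hA n).equalizer (g := fun x => lam • diagEntry A lam L (n + 1) (A x))
    (h := fun x => A (diagEntry A lam L n x)) (by fun_prop) (by fun_prop) <|
      funext fun z => ?_) x
  change lam • diagEntry A lam L (n + 1) (A ((A ^ n) z)) = A (diagEntry A lam L n ((A ^ n) z))
  rw [← mul_apply_eq_comp A, ← pow_succ', diagEntry_apply hA hL, diagEntry_apply hA hL, map_smul,
    pow_succ' lam⁻¹, mul_smul, smul_inv_smul₀ hlam, ← mul_apply_eq_comp A, ← pow_succ']

theorem diag_diagEntry_mem_extEigenspace (hA : ∀ n : ℕ, DenseRange (A ^ n : K →L[ℂ] K))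
    (hlam : lam ≠ 0) (hL : L ∈ deddens ‖lam‖ A A) :
    diag (diagEntry A lam L) (diagEntry_bounded hA hL) ∈ extEigenspace (tensorShift A) lam := by
  refine mem_extEigenspace_iff_apply.mpr fun f => ?_
  ext i
  rw [lp.coeFn_smul, Pi.smul_apply, diag_apply]
  cases i with
  | zero => rw [tensorShift_apply_zero, tensorShift_apply_zero, map_zero, smul_zero]
  | succ i =>
    rw [tensorShift_apply_succ, tensorShift_apply_succ, diag_apply,
      lam_smul_diagEntry_succ_apply hA hlam hL]

/-- The operators `(I ⊗ Sᵐ) diag(L, X₁₁, X₂₂, …)` on `K ⊗ H²` with `m ∈ ℕ` and `L ∈ 𝒜_{|lam|}(A)`,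
i.e. `generators` before conjugation by the model unitary. -/
def modelGenerators (A : K →L[ℂ] K) (hA : ∀ n : ℕ, DenseRange (A ^ n : K →L[ℂ] K)) (lam : ℂ) :
    Set (HardyTensor K →L[ℂ] HardyTensor K) :=
  {Y | ∃ (m : ℕ) (L : K →L[ℂ] K) (hL : L ∈ deddens ‖lam‖ A A),
    Y = (shift K ^ m) ∘L diag (diagEntry A lam L) (diagEntry_bounded hA hL)}

theorem modelGenerators_subset_extEigenspace (hA : ∀ n : ℕ, DenseRange (A ^ n : K →L[ℂ] K))
    (hlam : lam ≠ 0) : modelGenerators A hA lam ⊆ extEigenspace (tensorShift A) lam := by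
  rintro _ ⟨m, L, hL, rfl⟩
  exact comp_mem_extEigenspace ((tensorShift_commute_shift A).pow_right m)
    (diag_diagEntry_mem_extEigenspace hA hlam hL)

theorem fejerMean_mem_span_modelGenerators (hA : ∀ n : ℕ, DenseRange (A ^ n : K →L[ℂ] K))
    (hlam : lam ≠ 0) (hY : Y ∈ extEigenspace (tensorShift A) lam) (N : ℕ) :
    fejerMean Y N ∈ Submodule.span ℂ (modelGenerators A hA lam) :=
  Submodule.sum_mem _ fun m _ => Submodule.smul_mem _ _ <| Submodule.subset_span
    ⟨m, entry Y m 0, entry_mem_deddens hlam hY m,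
      congrArg _ (lowerDiagonal_eq_diag_diagEntry hA hlam hY m)⟩

theorem extEigenspace_tensorShift (hA : ∀ n : ℕ, DenseRange (A ^ n : K →L[ℂ] K))
    (hlam : lam ≠ 0) :
    (extEigenspace (tensorShift A) lam : Set (HardyTensor K →L[ℂ] HardyTensor K)) =
      weakStarSpan (modelGenerators A hA lam) := by
  refine Set.Subset.antisymm (fun Y hY => ?_)
    (weakStarSpan_subset_extEigenspace (modelGenerators_subset_extEigenspace hA hlam))
  have hA₁ : DenseRange A := by simpa only [pow_one] using hA 1
  let := weakStarTopology (HardyTensor K)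
  exact mem_closure_of_tendsto
    (tendsto_weakStar_fejerMean (isLowerTriangular_of_mem_extEigenspace hA₁ hlam hY))
    (Filter.Eventually.of_forall (fejerMean_mem_span_modelGenerators hA hlam hY))

end Intertwining

section Transport

variable {H : Type u} [NormedAddCommGroup H] [InnerProductSpace ℂ H] [CompleteSpace H]
  {T : H →L[ℂ] H} {hT : IsPureQuasinormal T} {U : H ≃ₗᵢ[ℂ] HardyTensor (defectSpace T)}

theorem IsModelUnitary.conj_tensorShift (hU : IsModelUnitary T hT U) :
    U.symm.toContinuousLinearEquiv.conjContinuousAlgEquiv (tensorShift (defectOp T hT)) = T := by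
  refine ContinuousLinearMap.ext fun x => ?_
  change U.symm (tensorShift (defectOp T hT) (U x)) = T x
  rw [← hU, U.symm_apply_apply, U.symm_apply_apply]

theorem generators_eq_image_modelGenerators (hT : IsPureQuasinormal T) (lam : ℂ)
    (U : H ≃ₗᵢ[ℂ] HardyTensor (defectSpace T)) :
    generators T hT lam U = U.symm.toContinuousLinearEquiv.conjContinuousAlgEquiv ''
      modelGenerators (defectOp T hT) (denseRange_defectOp_pow T hT) lam := by
  ext X
  constructor
  · rintro ⟨m, L, hL, rfl⟩
    exact ⟨_, ⟨m, L, hL, rfl⟩, rfl⟩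
  · rintro ⟨_, ⟨m, L, hL, rfl⟩, rfl⟩
    exact ⟨m, L, hL, rfl⟩

theorem IsModelUnitary.extEigenspace_eq (hU : IsModelUnitary T hT U) {lam : ℂ} (hlam : lam ≠ 0) :
    (extEigenspace T lam : Set (H →L[ℂ] H)) = weakStarSpan (generators T hT lam U) := by
  let e := U.symm.toContinuousLinearEquiv
  let A := defectOp T hT
  have hA := denseRange_defectOp_pow T hT
  calc (extEigenspace T lam : Set (H →L[ℂ] H))
      = extEigenspace (e.conjContinuousAlgEquiv (tensorShift A)) lam := by
        rw [hU.conj_tensorShift]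
    _ = e.conjContinuousAlgEquiv '' extEigenspace (tensorShift A) lam := extEigenspace_conj _ _ _
    _ = e.conjContinuousAlgEquiv '' weakStarSpan (modelGenerators A hA lam) := by
        rw [extEigenspace_tensorShift hA hlam]
    _ = weakStarSpan (e.conjContinuousAlgEquiv '' modelGenerators A hA lam) :=
        (weakStarSpan_image_conj e _).symm
    _ = weakStarSpan (generators T hT lam U) := by
        rw [generators_eq_image_modelGenerators]

end Transport

end ExtEig

end

theorem theorem4p1_general {H : Type*} [NormedAddCommGroup H] [InnerProductSpace ℂ H]
    [CompleteSpace H] (T : H →L[ℂ] H) (hT : ExtEig.IsPureQuasinormal T)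
    (lam : ℂ) (hlam : lam ≠ 0) :
    (∃ U : H ≃ₗᵢ[ℂ] ExtEig.HardyTensor (ExtEig.defectSpace T), ExtEig.IsModelUnitary T hT U) ∧
    ∀ U : H ≃ₗᵢ[ℂ] ExtEig.HardyTensor (ExtEig.defectSpace T), ExtEig.IsModelUnitary T hT U →
      (ExtEig.extEigenspace T lam : Set (H →L[ℂ] H)) =
        ExtEig.weakStarSpan (ExtEig.generators T hT lam U) :=
  ⟨ExtEig.exists_isModelUnitary hT, fun _ hU => hU.extEigenspace_eq hlam⟩

theorem theorem4p1 {H : Type*} [NormedAddCommGroup H] [InnerProductSpace ℂ H] [CompleteSpace H]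
    (T : H →L[ℂ] H) (hT : ExtEig.IsPureQuasinormal T)
    (lam : ℂ) (hlam : lam ∈ ExtEig.extSpectrum T) :
    (∃ U : H ≃ₗᵢ[ℂ] ExtEig.HardyTensor (ExtEig.defectSpace T), ExtEig.IsModelUnitary T hT U) ∧
    ∀ U : H ≃ₗᵢ[ℂ] ExtEig.HardyTensor (ExtEig.defectSpace T), ExtEig.IsModelUnitary T hT U →
      (ExtEig.extEigenspace T lam : Set (H →L[ℂ] H)) =
        ExtEig.weakStarSpan (ExtEig.generators T hT lam U) :=
  theorem4p1_general T hT lam (ExtEig.ne_zero_of_mem_extSpectrum hT hlam)
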